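/- Let $\Omega\subseteq\mathbb{R}^n$ be open and let $\mathcal{D}(\Omega)$ be the real vector space of smooth functions $\Omega\to\mathbb{R}$ with compact support in $\Omega$, with its usual locally convex topology (the locally convex inductive limit of the Fréchet spaces $\mathcal{D}_K(\Omega)$, $K\subseteq\Omega$ compact). Equip $\mathcal{D}(\Omega)$ with its canonical diffeology: for an open set $U\subseteq\mathbb{R}^m$ ($m\in\mathbb{N}$), a map $d:U\to\mathcal{D}(\Omega)$ is a plot if and only if $\lambda\circ d\in C^\infty(U,\mathbb{R})$ for every linear functional $\lambda:\mathcal{D}(\Omega)\to\mathbb{R}$ that is continuous in the locally convex topology. The $D$-topology on $\mathcal{D}(\Omega)$ is the final topology with respect to all plots, and a map $f:\mathcal{D}(\Omega)\to\mathbb{R}$ is (diffeologically) smooth if $f\circ d\in C^\infty(U,\mathbb{R})$ for every plot $d:U\to\mathcal{D}(\Omega)$. (a) For every linear map $l:\mathcal{D}(\Omega)\to\mathbb{R}$ the following are equivalent: (i) $l$ is continuous in the locally convex topology, i.e. $l$ is a distribution; (ii) $l$ is continuous in the $D$-topology; (iii) $l$ is smooth. In particular, every linear map $l$ that is continuous in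 the $D$-topology is smooth and is a distribution. (b) Let $U\subseteq\mathbb{R}^m$ be open, let $d:U\to\mathcal{D}(\Omega)$ be a plot, and let $e_i$ be a standard basis vector of $\mathbb{R}^m$. Then there is a plot $d':U\to\mathcal{D}(\Omega)$ such that, for all $u\in U$, $d'(u)(x)=\left.\frac{\partial}{\partial h}\right|_{h=0}d(u+he_i)(x)$ for all $x\in\Omega$ and $$\lim_{h\to0}\frac{d(u+he_i)-d(u)}{h}=d'(u)\quad\text{in the } D\text{-topology of }\mathcal{D}(\Omega).$$ -/

import Mathlib

open Topology TopologicalSpace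
open scoped ContDiff Distributions

/-- Let `V` be a real topological vector space and `U` an open subset of `ℝᵐ`. A map `d : U → V` is
a plot of the canonical diffeology of `V` (a figure of type `U`) if `l ∘ d` is smooth on `U` for
every continuous linear functional `l` on `V`. Here `d` is given as a function on all of `ℝᵐ`,
of which only the restriction to `U` matters. -/
def IsCanonicalPlotOn {V : Type*} [AddCommGroup V] [Module ℝ V] [TopologicalSpace V] {m : ℕ}
    (U : Set (EuclideanSpace ℝ (Fin m))) (d : EuclideanSpace ℝ (Fin m) → V) : Prop :=
  ∀ l : V →L[ℝ] ℝ, ContDiffOn ℝ ∞ (fun u => l (d u)) U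

/-- The canonical diffeology of a real topological vector space. Its D-topology is the final
topology with respect to all plots (the default of `CorePlotsOn`). -/
@[reducible]
def canonicalDiffeology (V : Type*) [AddCommGroup V] [Module ℝ V] [TopologicalSpace V] :
    DiffeologicalSpace V :=
  .ofCorePlotsOn {
    isPlotOn := fun {_ U} _ d => IsCanonicalPlotOn U d
    isPlotOn_congr := fun _ _ _ h =>
      forall_congr' fun l => contDiffOn_congr fun u hu => congrArg l (h hu)
    isPlot_const := fun _ _ => contDiffOn_const
    isPlotOn_reparam := fun _ _ _ h hp hf l => (hp l).comp hf h.subset_preimage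
    locality := fun _ _ h l u hu => by
      obtain ⟨v, hv, huv, hd⟩ := h u hu
      exact ((hd l u huv).contDiffAt (hv.mem_nhds huv)).contDiffWithinAt }

/-- The space `𝓓(Ω)` of real test functions on an open set `Ω ⊆ ℝⁿ`, regarded as a diffeological
space with the canonical diffeology of its locally convex (LF) topology. -/
noncomputable instance TestFunction.instDiffeologicalSpace {n : ℕ}
    {Ω : Opens (EuclideanSpace ℝ (Fin n))} : DiffeologicalSpace 𝓓(Ω, ℝ) :=
  canonicalDiffeology 𝓓(Ω, ℝ)

/-! Convergence in the D-topology is obtained by putting a sequence on one smooth curve. There is a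
universal rate `ε` such that, if every continuous functional is `O(ε k)` along `y`, then `v + y k`
lies on a plot through `v` (`exists_rate_tendsto_dTopology`). (a) A null sequence in the Fréchet
space `𝓓_K` has a subsequence of this rate, so a D-continuous `l` is continuous on every `𝓓_K`,
hence a distribution. (b) Under each functional the difference quotients of a plot are within `C *
|h|` of a limit. That limit comes from a test function: weakly bounded sequences have a common
compact support and uniform bounds on each derivative, so a telescoping series converges in `𝓓_K`
(`exists_weak_deriv`). The rate lemma then upgrades weak convergence to the D-topology. -/

open Filter Function

/-! ### Fast sequences lie on smooth curves -/

/-- There are smooth bumps on the line with disjoint supports, whose centres converge to `0`. -/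
theorem exists_disjoint_bumps : ∃ (τ : ℕ → EuclideanSpace ℝ (Fin 1))
    (b : ℕ → EuclideanSpace ℝ (Fin 1) → ℝ), Tendsto τ atTop (𝓝 0) ∧
    (∀ k, ContDiff ℝ ∞ (b k)) ∧ (∀ k, HasCompactSupport (b k)) ∧ (∀ k, b k (τ k) = 1) ∧
    (∀ k, b k 0 = 0) ∧ ∀ k j x, b k x ≠ 0 → b j x ≠ 0 → k = j := by
  let t : ℕ → ℝ := fun k => (1 / 2) ^ k
  have ht : ∀ k, 0 < t k := fun k => by positivity
  let τ : ℕ → EuclideanSpace ℝ (Fin 1) := fun k => EuclideanSpace.single 0 (t k)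
  -- For `k < j` the centres are at least `t k / 2` apart, while the outer radii add up to at most
  -- `3 * t k / 8`; `0` is at distance `t k`.
  let b : ∀ k, ContDiffBump (τ k) := fun k =>
    { rIn := t k / 8
      rOut := t k / 4
      rIn_pos := by have := ht k; positivity
      rIn_lt_rOut := by have := ht k; linarith }
  have hsupp : ∀ k x, b k x ≠ 0 → dist x (τ k) < t k / 4 := fun k x hx => by
    have : x ∈ support (b k) := hx
    rwa [(b k).support_eq] at this
  have hdist : ∀ k j x, k < j → b k x ≠ 0 → b j x = 0 := fun k j x hkj hk => by
    by_contra hj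
    have h1 := hsupp k x hk
    have h2 := hsupp j x hj
    have h3 : dist (τ k) (τ j) = |t k - t j| := by
      simp [τ, Real.dist_eq]
    have h4 : t j ≤ t (k + 1) := pow_le_pow_of_le_one (by norm_num) (by norm_num) hkj
    have h5 : t (k + 1) = t k / 2 := by simp only [t, pow_succ]; ring
    have h6 := dist_triangle_left (τ k) (τ j) x
    have h7 := le_abs_self (t k - t j)
    have := ht k
    linarith
  refine ⟨τ, fun k => b k, ?_, fun k => (b k).contDiff, fun k => (b k).hasCompactSupport,
    fun k => (b k).one_of_mem_closedBall (Metric.mem_closedBall_self (b k).rIn_pos.le), fun k => ?_, fun k j x hk hj => ?_⟩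
  · rw [tendsto_zero_iff_norm_tendsto_zero]
    have : (fun k => ‖τ k‖) = t := funext fun k => by
      simp [τ, abs_of_pos (ht k)]
    rw [this]
    exact tendsto_pow_atTop_nhds_zero_of_lt_one (by norm_num) (by norm_num)
  · by_contra h
    have h1 := hsupp k 0 h
    have := ht k
    simp only [dist_zero_left, τ, PiLp.norm_single, Real.norm_eq_abs,
      abs_of_pos this] at h1
    linarith
  · rcases lt_trichotomy k j with h | h | h
    · exact absurd (hdist k j x h hk) hj
    · exact h
    · exact absurd (hdist j k x h hj) hk

/-- The derivatives up to order `k` of a compactly supported smooth function are bounded. -/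
theorem exists_bound_iteratedFDeriv_le {E : Type*} [NormedAddCommGroup E] [NormedSpace ℝ E]
    {f : E → ℝ} (hf : ContDiff ℝ ∞ f) (hs : HasCompactSupport f) (k : ℕ) :
    ∃ M : ℝ, 0 ≤ M ∧ ∀ i ≤ k, ∀ x, ‖iteratedFDeriv ℝ i f x‖ ≤ M := by
  have (i : ℕ) : ∃ C, ∀ x, ‖iteratedFDeriv ℝ i f x‖ ≤ C :=
    (hf.continuous_iteratedFDeriv (mod_cast le_top)).bounded_above_of_compact_support
      (hs.iteratedFDeriv i)
  choose C hC using this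
  refine ⟨∑ i ∈ Finset.range (k + 1), |C i|, Finset.sum_nonneg fun _ _ => abs_nonneg _,
    fun i hi x => (hC i x).trans ((le_abs_self _).trans ?_)⟩
  exact Finset.single_le_sum (f := fun i => |C i|) (fun _ _ => abs_nonneg _)
    (Finset.mem_range.2 (Nat.lt_succ_of_le hi))

/-- A sequence that decays sufficiently fast under every continuous linear functional lies on a
smooth curve through `0`, and therefore converges in the D-topology. -/
theorem exists_rate_tendsto_dTopology (V : Type*) [AddCommGroup V] [Module ℝ V]
    [TopologicalSpace V] :
    ∃ ε : ℕ → ℝ, (∀ k, 0 < ε k) ∧ ∀ y : ℕ → V,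
      (∀ l : V →L[ℝ] ℝ, ∃ C, ∀ᶠ k in atTop, |l (y k)| ≤ C * ε k) →
      ∀ v, Tendsto (fun k => v + y k) atTop (@nhds V (canonicalDiffeology V).dTopology v) := by
  obtain ⟨τ, b, hτ, hb, hbs, hb1, hb0, hdisj⟩ := exists_disjoint_bumps
  choose M hM0 hM using fun k => exists_bound_iteratedFDeriv_le (hb k) (hbs k) k
  have hM1 (k : ℕ) : 0 < M k + 1 := by linarith [hM0 k]
  -- Dividing by the bound on the derivatives of `b k` of order at most `k` makes the series of
  -- `i`-th derivatives geometric from `k = i` on. The rate involves neither `y` nor `v`.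
  refine ⟨fun k => (1 / 2) ^ k / (M k + 1), fun k => by have := hM1 k; positivity,
    fun y hy v => ?_⟩
  have hfin (x) : (support fun k => b k x • y k).Finite := by
    refine Set.Subsingleton.finite fun k hk j hj => hdisj k j x ?_ ?_
    · exact fun h => hk (by simp [h])
    · exact fun h => hj (by simp [h])
  -- At most one term is nonzero at each point, so no convergence in `V` is needed.
  let c : EuclideanSpace ℝ (Fin 1) → V := fun x => v + ∑ᶠ k, b k x • y k
  have hc : IsCanonicalPlotOn Set.univ c := fun l => by
    obtain ⟨C, hC⟩ := hy l
    have hlc : (fun x => l (c x)) = fun x => l v + ∑' k, l (y k) • b k x := funext fun x => by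
      have h2 : (support fun k => l (y k) • b k x).Finite :=
        (hfin x).subset fun k hk h => hk <| by
          have := congrArg l h
          simpa [mul_comm] using this
      rw [tsum_eq_finsum h2, map_add]
      congr 1
      refine (AddMonoidHom.map_finsum (l : V →+ ℝ) (hfin x)).trans (finsum_congr fun k => ?_)
      simp [mul_comm]
    rw [hlc, contDiffOn_univ]
    refine contDiff_const.add (contDiff_tsum_of_eventually (N := ⊤)
      (v := fun _ k => |C| * (1 / 2) ^ k) (fun k => (hb k).const_smul _)
      (fun _ _ => Summable.mul_left _ (summable_geometric_of_lt_one (by norm_num) (by norm_num)))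
      fun i _ => ?_)
    rw [Nat.cofinite_eq_atTop]
    filter_upwards [hC, eventually_ge_atTop i] with k hk hik x
    have h1 : iteratedFDeriv ℝ i (fun x => l (y k) • b k x) x =
        l (y k) • iteratedFDeriv ℝ i (b k) x :=
      iteratedFDeriv_const_smul_apply' (((hb k).of_le (mod_cast le_top)).contDiffAt)
    rw [h1, norm_smul, Real.norm_eq_abs]
    have hε : 0 < (1 / 2 : ℝ) ^ k / (M k + 1) := by have := hM1 k; positivity
    calc |l (y k)| * ‖iteratedFDeriv ℝ i (b k) x‖
        ≤ (|C| * ((1 / 2) ^ k / (M k + 1))) * (M k + 1) := by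
          refine mul_le_mul (hk.trans ?_) ((hM k i hik x).trans (by linarith)) (norm_nonneg _)
            (by positivity)
          gcongr
          exact le_abs_self C
      _ = |C| * (1 / 2) ^ k := by rw [mul_assoc, div_mul_cancel₀ _ (hM1 k).ne']
  have hcont := @Diffeology.IsPlot.continuous V (canonicalDiffeology V) 1 c hc
  have hc0 : c 0 = v := by simp [c, hb0]
  have hcτ (k : ℕ) : c (τ k) = v + y k := by
    simp only [c]
    rw [finsum_eq_single _ k, hb1, one_smul]
    intro j hj
    have : b j (τ k) = 0 := by
      by_contra h
      exact hj (hdisj j k (τ k) h (by simp [hb1]))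
    rw [this, zero_smul]
  let _ : TopologicalSpace V := (canonicalDiffeology V).dTopology
  have := (hcont.tendsto 0).comp hτ
  rw [hc0] at this
  exact this.congr hcτ

/-! ### Weakly bounded families of test functions -/

/-- A family in a normed space that is bounded under every continuous functional is bounded. -/
theorem exists_norm_le_of_forall_dual {ι Y : Type*} [NormedAddCommGroup Y] [NormedSpace ℝ Y]
    {y : ι → Y} (hy : ∀ l : Y →L[ℝ] ℝ, ∃ C, ∀ i, |l (y i)| ≤ C) : ∃ C, ∀ i, ‖y i‖ ≤ C := by
  -- Uniform boundedness is applied on the dual, which is complete even if `Y` is not.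
  obtain ⟨C, hC⟩ := banach_steinhaus (g := fun i => NormedSpace.inclusionInDoubleDualLi ℝ (y i))
    hy
  exact ⟨C, fun i => (LinearIsometry.norm_map _ (y i)).symm.trans_le (hC i)⟩

/-- Continuous linear maps to normed spaces send weakly bounded families to bounded families. -/
theorem exists_norm_map_le {ι V Y : Type*} [AddCommGroup V] [Module ℝ V] [TopologicalSpace V]
    [NormedAddCommGroup Y] [NormedSpace ℝ Y] {r : ι → V}
    (hr : ∀ l : V →L[ℝ] ℝ, ∃ C, ∀ i, |l (r i)| ≤ C) (T : V →L[ℝ] Y) :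
    ∃ C, ∀ i, ‖T (r i)‖ ≤ C :=
  exists_norm_le_of_forall_dual fun l => hr (l.comp T)

namespace TestFunction

variable {E : Type*} [NormedAddCommGroup E] [NormedSpace ℝ E] {Ω : Opens E}

/-- If the points `x k` eventually leave every compact subset of `Ω`, then
`f ↦ ∑ f (x k) • e k` is a continuous linear map on test functions. -/
theorem exists_clm_eq_sum {Y : Type*} [NormedAddCommGroup Y] [NormedSpace ℝ Y] (x : ℕ → E)
    (hx : ∀ K : Set E, IsCompact K → K ⊆ Ω → ∃ N, ∀ k ≥ N, x k ∉ K) (e : ℕ → Y) :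
    ∃ T : 𝓓(Ω, ℝ) →L[ℝ] Y, ∀ f, (support fun k => f (x k) • e k).Finite ∧
      T f = ∑ᶠ k, f (x k) • e k := by
  have hsub {f : E → ℝ} {N : ℕ} {K : Set E} (hf : support f ⊆ K) (hN : ∀ k ≥ N, x k ∉ K) :
      (support fun k => f (x k) • e k) ⊆ Finset.range N := fun k hk => by
    by_contra h
    refine hN k (by simpa using h) (hf fun h0 => hk ?_)
    simp [h0]
  have hfin (f : 𝓓(Ω, ℝ)) : (support fun k => f (x k) • e k).Finite := by
    obtain ⟨N, hN⟩ := hx _ f.hasCompactSupport f.tsupport_subset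
    exact (Finset.finite_toSet _).subset (hsub (subset_tsupport f) hN)
  refine ⟨TestFunction.mkCLM ℝ (fun f => ∑ᶠ k, f (x k) • e k) (fun f g => ?_) (fun c f => ?_)
    fun K hK => ?_, fun f => ⟨hfin f, rfl⟩⟩
  · rw [← finsum_add_distrib (hfin f) (hfin g)]
    exact finsum_congr fun k => by simp [add_smul]
  · rw [smul_finsum' _ (hfin f)]
    exact finsum_congr fun k => by simp [mul_smul]
  · obtain ⟨N, hN⟩ := hx _ K.isCompact hK
    have : (fun f : 𝓓(Ω, ℝ) => ∑ᶠ k, f (x k) • e k) ∘ ofSupportedIn hK =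
        fun f : 𝓓_{K}(E, ℝ) => ∑ k ∈ Finset.range N, f (x k) • e k := funext fun f =>
      finsum_eq_sum_of_support_subset _ (hsub f.support_subset hN)
    rw [this]
    exact continuous_finsetSum _ fun k _ =>
      ((continuous_eval_const (x k)).smul continuous_const)

/-- A weakly bounded family of test functions is supported in a common compact subset of `Ω`. -/
theorem exists_compacts_of_weakly_bounded [FiniteDimensional ℝ E] {ι : Type*} {r : ι → 𝓓(Ω, ℝ)}
    (hr : ∀ l : 𝓓(Ω, ℝ) →L[ℝ] ℝ, ∃ C, ∀ i, |l (r i)| ≤ C) :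
    ∃ K : Compacts E, (K : Set E) ⊆ Ω ∧ ∀ i, support (r i) ⊆ K := by
  have : ProperSpace E := FiniteDimensional.proper ℝ E
  have : LocallyCompactSpace Ω := Ω.isOpen.locallyCompactSpace
  let X : CompactExhaustion Ω := default
  let K (k : ℕ) : Compacts E := ⟨Subtype.val '' X k, (X.isCompact k).image continuous_subtype_val⟩
  have hK (k : ℕ) : (K k : Set E) ⊆ Ω := by
    rintro _ ⟨x, -, rfl⟩
    exact x.2
  by_contra! h
  choose i hi using fun k => h (K k) (hK k)
  choose x hx hxK using fun k => Set.not_subset.1 (hi k)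
  have hleave (L : Set E) (hL : IsCompact L) (hLΩ : L ⊆ Ω) : ∃ N, ∀ k ≥ N, x k ∉ L := by
    obtain ⟨N, hN⟩ := X.exists_superset_of_isCompact
      (Topology.IsInducing.subtypeVal.isCompact_preimage_iff
        (by simpa using hLΩ) |>.2 hL)
    refine ⟨N, fun k hk hxk => hxK k ⟨⟨x k, hLΩ hxk⟩, X.subset hk (hN hxk), rfl⟩⟩
  -- Normalised so that the `k`-th coordinate of `T (r (i k))` is `k`, making `T` unbounded on the
  -- family.
  let a (k : ℕ) : ℝ := k / r (i k) (x k)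
  let e (k : ℕ) : BoundedContinuousFunction ℕ ℝ :=
    .ofNormedAddCommGroupDiscrete (Pi.single k (a k)) |a k| fun j => by
      rcases eq_or_ne j k with rfl | hj
      · simp
      · simp [hj]
  obtain ⟨T, hT⟩ := exists_clm_eq_sum x hleave e
  obtain ⟨C, hC⟩ := exists_norm_map_le hr T
  obtain ⟨k, hk⟩ := exists_nat_gt C
  have h1 : T (r (i k)) k = k := by
    rw [(hT _).2, finsum_eq_sum _ (hT _).1, BoundedContinuousFunction.sum_apply]
    rw [Finset.sum_eq_single k]
    · simp [e, a, mul_div_cancel₀ _ (hx k)]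
    · intro j _ hj
      simp [e, hj.symm]
    · intro hk
      simp only [Set.Finite.mem_toFinset, notMem_support] at hk
      simp [hk]
  have h2 := ((T (r (i k))).norm_coe_le_norm k).trans (hC (i k))
  rw [h1] at h2
  simp at h2
  linarith

/-- The iterated derivative of test functions as a continuous linear map. -/
theorem exists_clm_iteratedFDeriv (Ω : Opens E) (i : ℕ) :
    ∃ T : 𝓓(Ω, ℝ) →L[ℝ] BoundedContinuousFunction E (E [×i]→L[ℝ] ℝ),
      ∀ f x, T f x = iteratedFDeriv ℝ i f x := by
  have hc (f : 𝓓(Ω, ℝ)) : Continuous (iteratedFDeriv ℝ i f) :=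
    f.contDiff.continuous_iteratedFDeriv (mod_cast le_top)
  choose C hC using fun f : 𝓓(Ω, ℝ) =>
    (hc f).bounded_above_of_compact_support (f.hasCompactSupport.iteratedFDeriv i)
  refine ⟨TestFunction.limitCLM ℝ
    (fun f => BoundedContinuousFunction.ofNormedAddCommGroup _ (hc f) (C f) (hC f))
    (fun K _ => ContDiffMapSupportedIn.structureMapCLM ℝ ⊤ i) fun K hK f => ?_, fun f x => rfl⟩
  ext1 x
  simp [ContDiffMapSupportedIn.structureMapCLM_apply]

/-- If `r` is a weakly bounded sequence of test functions, the series `∑ 2⁻ᵏ r k` converges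
weakly to a test function. -/
theorem exists_tendsto_sum_of_weakly_bounded [FiniteDimensional ℝ E] {r : ℕ → 𝓓(Ω, ℝ)}
    (hr : ∀ l : 𝓓(Ω, ℝ) →L[ℝ] ℝ, ∃ C, ∀ k, |l (r k)| ≤ C) :
    ∃ f : 𝓓(Ω, ℝ), ∀ l : 𝓓(Ω, ℝ) →L[ℝ] ℝ, Tendsto
      (fun n => ∑ k ∈ Finset.range n, (1 / 2 : ℝ) ^ k * l (r k)) atTop (𝓝 (l f)) := by
  obtain ⟨K, hKΩ, hK⟩ := exists_compacts_of_weakly_bounded hr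
  -- Differentiation of order `i` is continuous into a normed space of bounded functions, where weak
  -- boundedness is boundedness.
  have hM (i : ℕ) : ∃ M, ∀ k x, ‖iteratedFDeriv ℝ i (r k) x‖ ≤ M := by
    obtain ⟨T, hT⟩ := exists_clm_iteratedFDeriv Ω i
    obtain ⟨M, hM⟩ := exists_norm_map_le (Y := BoundedContinuousFunction E (E [×i]→L[ℝ] ℝ)) hr T
    exact ⟨M, fun k x => hT (r k) x ▸ ((T (r k)).norm_coe_le_norm x).trans (hM k)⟩
  choose M hM using hM
  let s (k : ℕ) : 𝓓_{K}(E, ℝ) := (1 / 2 : ℝ) ^ k • .of_support_subset (r k).contDiff (hK k)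
  have hs (i k : ℕ) (x : E) : ‖iteratedFDeriv ℝ i (s k) x‖ ≤ M i * (1 / 2) ^ k := by
    have h1 : iteratedFDeriv ℝ i (s k) x = (1 / 2 : ℝ) ^ k • iteratedFDeriv ℝ i (r k) x :=
      iteratedFDeriv_const_smul_apply ((r k).contDiff.of_le (mod_cast le_top)).contDiffAt
    rw [h1, norm_smul, mul_comm, norm_pow, Real.norm_of_nonneg (by norm_num : (0 : ℝ) ≤ 1 / 2)]
    gcongr
    exact hM i k x
  have hsum (i : ℕ) : Summable fun k => M i * (1 / 2 : ℝ) ^ k :=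
    (summable_geometric_of_lt_one (by norm_num) (by norm_num)).mul_left _
  let F : 𝓓_{K}(E, ℝ) :=
    { toFun := fun x => ∑' k, s k x
      contDiff' := contDiff_tsum (fun k => (s k).contDiff) (fun i _ => hsum i)
        fun i k x _ => hs i k x
      zero_on_compl' := fun x hx => by
        simp [fun k => (s k).zero_on_compl hx] }
  have hF (i : ℕ) (x : E) : iteratedFDeriv ℝ i F x = ∑' k, iteratedFDeriv ℝ i (s k) x :=
    iteratedFDeriv_tsum_apply (N := ⊤) (fun k => (s k).contDiff) (fun i _ => hsum i)
      (fun i k x _ => hs i k x) (mod_cast le_top) x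
  have htend : Tendsto (fun n => ∑ k ∈ Finset.range n, s k) atTop (𝓝 F) := by
    rw [(ContDiffMapSupportedIn.withSeminorms ℝ E ℝ ⊤ K).tendsto_nhds]
    intro i ε hε
    have htail := tendsto_sum_nat_add fun k => M i * (1 / 2 : ℝ) ^ k
    filter_upwards [htail.eventually_lt_const (half_pos hε)] with n hn
    refine lt_of_le_of_lt ?_ (half_lt_self hε)
    rw [ContDiffMapSupportedIn.seminorm_top_le_iff ℝ (half_pos hε).le]
    intro x _
    have hsx : Summable fun k => iteratedFDeriv ℝ i (s k) x :=
      .of_norm_bounded (hsum i) fun k => hs i k x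
    have h1 : iteratedFDeriv ℝ i (⇑(∑ k ∈ Finset.range n, s k - F)) x =
        -∑' k, iteratedFDeriv ℝ i (s (k + n)) x := by
      obtain ⟨T, hT⟩ : ∃ T : 𝓓_{K}(E, ℝ) →ₗ[ℝ] (E [×i]→L[ℝ] ℝ),
          ∀ f, T f = iteratedFDeriv ℝ i f x :=
        ⟨{ toFun := fun f => ContDiffMapSupportedIn.structureMapLM ℝ ⊤ i f x
           map_add' := by simp
           map_smul' := by simp }, fun f => by
            simp [ContDiffMapSupportedIn.structureMapLM_top_apply]⟩
      rw [← hT, map_sub, map_sum, hT, hF, ← hsx.sum_add_tsum_nat_add n]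
      simp [hT]
    rw [h1, norm_neg]
    exact (tsum_of_norm_bounded ((summable_nat_add_iff n).2 (hsum i)).hasSum
      fun k => hs i (k + n) x).trans hn.le
  refine ⟨ofSupportedIn hKΩ F, fun l => ?_⟩
  let L : 𝓓_{K}(E, ℝ) →L[ℝ] ℝ := l.comp (ofSupportedInCLM ℝ hKΩ)
  refine ((L.continuous.tendsto F).comp htend).congr fun n => ?_
  rw [comp_apply, map_sum]
  refine Finset.sum_congr rfl fun k _ => ?_
  rw [show s k = (1 / 2 : ℝ) ^ k • .of_support_subset (r k).contDiff (hK k) from rfl, map_smul]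
  rfl

end TestFunction

/-! ### D-continuous functionals are distributions -/

namespace TestFunction

/-- A linear functional on test functions that is continuous in the D-topology is a
distribution. -/
theorem continuous_of_continuous_dTopology {n : ℕ} {Ω : Opens (EuclideanSpace ℝ (Fin n))}
    {l : 𝓓(Ω, ℝ) →ₗ[ℝ] ℝ} (hl : Continuous[Diffeology.dTopology, inferInstance] l) :
    Continuous l := by
  obtain ⟨ε, hε, H⟩ := exists_rate_tendsto_dTopology 𝓓(Ω, ℝ)
  rw [TestFunction.continuous_iff_continuous_comp]
  intro K hK
  let L : 𝓓_{K}(EuclideanSpace ℝ (Fin n), ℝ) →ₗ[ℝ] ℝ := l ∘ₗ (ofSupportedInCLM ℝ hK).toLinearMap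
  have hp := ContDiffMapSupportedIn.withSeminorms ℝ (EuclideanSpace ℝ (Fin n)) ℝ ⊤ K
  have := hp.firstCountableTopology
  suffices h : Tendsto L (𝓝 0) (𝓝 0) from
    continuous_of_continuousAt_zero L (by simpa [ContinuousAt] using h)
  refine tendsto_of_subseq_tendsto fun ns hns => ?_
  rw [hp.tendsto_nhds] at hns
  -- Diagonal choice: a continuous functional is controlled by finitely many seminorms, all of them
  -- among the first `k` once `k` is large.
  have hms (k : ℕ) : ∃ m, ∀ i ∈ Finset.range k,
      ContDiffMapSupportedIn.seminorm ℝ _ ℝ ⊤ K i (ns m) ≤ ε k := by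
    refine (((Finset.range k).eventually_all.2 fun i _ => hns i (ε k) (hε k)).mono
      fun m hm i hi => ?_).exists
    simpa using (hm i hi).le
  choose ms hms using hms
  refine ⟨ms, ?_⟩
  have h0 := H (fun k => ofSupportedIn hK (ns (ms k))) (fun lam => ?_) 0
  · have h1 := ((@continuous_iff_continuousAt _ _ Diffeology.dTopology _ _).1 hl 0)
    have h2 := Tendsto.comp h1 h0
    simpa using! h2
  · let q : Seminorm ℝ 𝓓_{K}(EuclideanSpace ℝ (Fin n), ℝ) :=
      (normSeminorm ℝ ℝ).comp (lam.comp (ofSupportedInCLM ℝ hK)).toLinearMap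
    have hq : Continuous q :=
      continuous_norm.comp (lam.comp (ofSupportedInCLM ℝ hK)).continuous
    obtain ⟨s, C, -, hC⟩ := Seminorm.bound_of_continuous hp q hq
    refine ⟨C, ?_⟩
    obtain ⟨N, hN⟩ := s.exists_nat_subset_range
    filter_upwards [eventually_ge_atTop N] with k hk
    refine (hC (ns (ms k))).trans ?_
    refine mul_le_mul_of_nonneg_left (Seminorm.finset_sup_apply_le (hε k).le fun i hi => ?_) C.2
    exact hms k i (Finset.mem_range.2 ((Finset.mem_range.1 (hN hi)).trans_le hk))

end TestFunction

/-! ### Derivatives of plots -/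

/-- The first-order Taylor remainder of a `C²` function is quadratic. -/
theorem ContDiffAt.exists_abs_slope_sub_deriv_le {g : ℝ → ℝ} (hg : ContDiffAt ℝ 2 g 0) :
    ∃ C, 0 ≤ C ∧ ∀ᶠ h in 𝓝[≠] (0 : ℝ), |h⁻¹ * (g h - g 0) - deriv g 0| ≤ C * |h| := by
  have h1 : DifferentiableAt ℝ (deriv g) 0 := by
    have : ContDiffAt ℝ 1 (fun x => fderiv ℝ g x 1) 0 :=
      (hg.fderiv_right (m := 1) (by norm_num)).clm_apply contDiffAt_const
    exact (this.differentiableAt one_ne_zero :)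
  obtain ⟨C, hC0, hC⟩ := h1.isBigO_sub.exists_nonneg
  have hd : ∀ᶠ x in 𝓝 (0 : ℝ), DifferentiableAt ℝ g x :=
    (hg.eventually (by simp)).mono fun x hx => hx.differentiableAt two_ne_zero
  obtain ⟨δ, hδ, hball⟩ := Metric.eventually_nhds_iff_ball.1 (hC.bound.and hd)
  refine ⟨C, hC0, ?_⟩
  filter_upwards [self_mem_nhdsWithin, nhdsWithin_le_nhds (Metric.ball_mem_nhds 0 hδ)]
    with h hne hh
  have hsub : Metric.closedBall (0 : ℝ) |h| ⊆ Metric.ball 0 δ :=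
    Metric.closedBall_subset_ball (by simpa using hh)
  have hmem : h ∈ Metric.closedBall (0 : ℝ) |h| := by simp
  -- Mean value inequality for `g x - deriv g 0 * x`, whose derivative is at most `C * |h|` on this
  -- ball.
  have h2 := (convex_closedBall (0 : ℝ) |h|).norm_image_sub_le_of_norm_hasDerivWithin_le
    (f := fun x => g x - deriv g 0 * x) (f' := fun x => deriv g x - deriv g 0) (C := C * |h|)
    (fun x hx => ((hball x (hsub hx)).2.hasDerivAt.sub
      (by simpa using (hasDerivAt_id x).const_mul (deriv g 0))).hasDerivWithinAt)
    (fun x hx => by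
      have := (hball x (hsub hx)).1
      simp only [sub_zero] at this
      exact this.trans (mul_le_mul_of_nonneg_left (by simpa using hx) hC0))
    (Metric.mem_closedBall_self (abs_nonneg h)) hmem
  simp only [mul_zero, sub_zero, Real.norm_eq_abs] at h2
  have hne : h ≠ 0 := hne
  have e : h⁻¹ * (g h - g 0) - deriv g 0 = h⁻¹ * (g h - deriv g 0 * h - g 0) := by
    field_simp
    ring
  rw [e, abs_mul, abs_inv, inv_mul_le_iff₀ (abs_pos.2 hne)]
  linarith

/-- A weakly `C²` curve of test functions has a weak derivative that is a test function. -/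
theorem TestFunction.exists_weak_deriv {E : Type*} [NormedAddCommGroup E] [NormedSpace ℝ E]
    [FiniteDimensional ℝ E] {Ω : Opens E} {c : ℝ → 𝓓(Ω, ℝ)}
    (hc : ∀ l : 𝓓(Ω, ℝ) →L[ℝ] ℝ, ContDiffAt ℝ 2 (fun h => l (c h)) 0) :
    ∃ f : 𝓓(Ω, ℝ), ∀ l : 𝓓(Ω, ℝ) →L[ℝ] ℝ, deriv (fun h => l (c h)) 0 = l f := by
  let q (h : ℝ) : 𝓓(Ω, ℝ) := h⁻¹ • (c h - c 0)
  let t (k : ℕ) : ℝ := (1 / 2) ^ k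
  have ht : Tendsto t atTop (𝓝[≠] 0) := by
    refine tendsto_nhdsWithin_iff.2
      ⟨tendsto_pow_atTop_nhds_zero_of_lt_one (by norm_num) (by norm_num),
        .of_forall fun k => ?_⟩
    simp [t]
  have hq (l : 𝓓(Ω, ℝ) →L[ℝ] ℝ) : ∃ C, 0 ≤ C ∧
      ∀ᶠ h in 𝓝[≠] (0 : ℝ), |l (q h) - deriv (fun h => l (c h)) 0| ≤ C * |h| := by
    obtain ⟨C, hC0, hC⟩ := (hc l).exists_abs_slope_sub_deriv_le
    exact ⟨C, hC0, by simpa [q] using hC⟩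
  -- Consecutive quotients differ weakly by `O(2⁻ᵏ)`, so `r` is weakly bounded, and `∑ 2⁻ᵏ r k`
  -- telescopes to the limit minus `q (t 0)`.
  let r (k : ℕ) : 𝓓(Ω, ℝ) := (2 : ℝ) ^ k • (q (t (k + 1)) - q (t k))
  have hr (l : 𝓓(Ω, ℝ) →L[ℝ] ℝ) : ∃ C, ∀ k, |l (r k)| ≤ C := by
    obtain ⟨C, hC0, hC⟩ := hq l
    have hC' := ht.eventually hC
    have hev : ∀ᶠ k in atTop, |l (r k)| ≤ 2 * C := by
      filter_upwards [hC', (tendsto_add_atTop_nat 1).eventually hC'] with k hk hk1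
      have e1 : |t k| = (1 / 2) ^ k := abs_of_pos (by positivity)
      have e2 : |t (k + 1)| ≤ (1 / 2) ^ k := by
        rw [abs_of_pos (by positivity)]
        exact pow_le_pow_of_le_one (by norm_num) (by norm_num) k.le_succ
      have e3 : |l (q (t (k + 1))) - l (q (t k))| ≤ 2 * C * (1 / 2) ^ k := by
        rw [e1] at hk
        have := mul_le_mul_of_nonneg_left e2 hC0
        rw [abs_le] at hk hk1 ⊢
        constructor <;> linarith [hk.1, hk.2, hk1.1, hk1.2]
      simp only [r, map_smul, map_sub, smul_eq_mul, abs_mul, abs_pow, Nat.abs_ofNat]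
      calc (2 : ℝ) ^ k * |l (q (t (k + 1))) - l (q (t k))|
          ≤ 2 ^ k * (2 * C * (1 / 2) ^ k) := by gcongr
        _ = 2 * C * (2 * (1 / 2)) ^ k := by rw [mul_pow]; ring
        _ = 2 * C := by norm_num
    obtain ⟨N, hN⟩ := eventually_atTop.1 hev
    refine ⟨2 * C + ∑ k ∈ Finset.range N, |l (r k)|, fun k => ?_⟩
    have hs := Finset.sum_nonneg fun k (_ : k ∈ Finset.range N) => abs_nonneg (l (r k))
    rcases lt_or_ge k N with hk | hk
    · have := Finset.single_le_sum (f := fun k => |l (r k)|) (fun _ _ => abs_nonneg _)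
        (Finset.mem_range.2 hk)
      linarith
    · linarith [hN k hk]
  obtain ⟨f, hf⟩ := TestFunction.exists_tendsto_sum_of_weakly_bounded hr
  refine ⟨q (t 0) + f, fun l => ?_⟩
  have h1 : Tendsto (fun k => l (q (t k))) atTop (𝓝 (deriv (fun h => l (c h)) 0)) := by
    obtain ⟨C, -, hC⟩ := hq l
    refine Tendsto.comp (g := fun h => l (q h)) ?_ ht
    refine tendsto_iff_norm_sub_tendsto_zero.2 (squeeze_zero' (.of_forall fun _ => norm_nonneg _)
      (hC.mono fun h hh => by simpa using hh) ?_)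
    have : Tendsto (fun h : ℝ => C * |h|) (𝓝 0) (𝓝 0) :=
      (by fun_prop : Continuous fun h : ℝ => C * |h|).tendsto' _ _ (by simp)
    exact this.mono_left nhdsWithin_le_nhds
  refine tendsto_nhds_unique h1 ?_
  rw [map_add]
  refine ((hf l).const_add (l (q (t 0)))).congr fun k => ?_
  have (j : ℕ) : (1 / 2 : ℝ) ^ j * l (r j) = l (q (t (j + 1))) - l (q (t j)) := by
    simp only [r, map_smul, map_sub, smul_eq_mul]
    rw [← mul_assoc, ← mul_pow]
    norm_num
  rw [Finset.sum_congr rfl fun j _ => this j, Finset.sum_range_sub fun j => l (q (t j))]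
  ring

/-- If `c` is weakly `C²` at `0` with weak derivative `f`, then its difference quotients converge
to `f` in the D-topology of the canonical diffeology. -/
theorem tendsto_dTopology_slope {V : Type*} [AddCommGroup V] [Module ℝ V] [TopologicalSpace V]
    {c : ℝ → V} {f : V} (hc : ∀ l : V →L[ℝ] ℝ, ContDiffAt ℝ 2 (fun h => l (c h)) 0)
    (hf : ∀ l : V →L[ℝ] ℝ, deriv (fun h => l (c h)) 0 = l f) :
    Tendsto (fun h : ℝ => h⁻¹ • (c h - c 0)) (𝓝[≠] 0)
      (@nhds V (canonicalDiffeology V).dTopology f) := by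
  obtain ⟨ε, hε, H⟩ := exists_rate_tendsto_dTopology V
  refine tendsto_of_subseq_tendsto fun ns hns => ?_
  have hns0 : Tendsto (fun k => |ns k|) atTop (𝓝 0) := by
    simpa using (hns.mono_right nhdsWithin_le_nhds).abs
  -- The first condition gives the rate; `k ≤ ms k` keeps the subsequence tending to `0`, where the
  -- quadratic remainder bound holds.
  choose ms hms hmk using fun k =>
    ((hns0.eventually_le_const (hε k)).and (eventually_ge_atTop k)).exists
  refine ⟨ms, (H (fun k => (ns (ms k))⁻¹ • (c (ns (ms k)) - c 0) - f) (fun l => ?_) f).congr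
    fun k => by simp⟩
  obtain ⟨C, hC0, hC⟩ := (hc l).exists_abs_slope_sub_deriv_le
  refine ⟨C, ((hns.comp (tendsto_atTop_mono hmk tendsto_id)).eventually hC).mono fun k hk => ?_⟩
  rw [hf] at hk
  simp only [map_sub, map_smul, smul_eq_mul]
  exact hk.trans (mul_le_mul_of_nonneg_left (hms k) hC0)

/-- A plot of `𝓓(Ω)` has a directional derivative, which is again a plot. -/
theorem IsCanonicalPlotOn.exists_lineDeriv {n : ℕ} {Ω : Opens (EuclideanSpace ℝ (Fin n))} {m : ℕ}
    {U : Set (EuclideanSpace ℝ (Fin m))} (hU : IsOpen U)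
    {d : EuclideanSpace ℝ (Fin m) → 𝓓(Ω, ℝ)} (hd : IsCanonicalPlotOn U d)
    (e : EuclideanSpace ℝ (Fin m)) :
    ∃ d' : EuclideanSpace ℝ (Fin m) → 𝓓(Ω, ℝ), IsCanonicalPlotOn U d' ∧ ∀ u ∈ U,
      (∀ x, HasDerivAt (fun h : ℝ => d (u + h • e) x) (d' u x) 0) ∧
      Tendsto (fun h : ℝ => h⁻¹ • (d (u + h • e) - d u)) (𝓝[≠] 0)
        (@nhds 𝓓(Ω, ℝ) Diffeology.dTopology (d' u)) := by
  have hat (l : 𝓓(Ω, ℝ) →L[ℝ] ℝ) (u) (hu : u ∈ U) :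
      ContDiffAt ℝ ∞ (fun u => l (d u)) u := (hd l).contDiffAt (hU.mem_nhds hu)
  have hc (u) (hu : u ∈ U) (l : 𝓓(Ω, ℝ) →L[ℝ] ℝ) :
      ContDiffAt ℝ 2 (fun h : ℝ => l (d (u + h • e))) 0 := by
    refine ContDiffAt.comp (g := fun u => l (d u)) (0 : ℝ) ?_
      (by fun_prop : ContDiff ℝ 2 fun h : ℝ => u + h • e).contDiffAt
    simpa using (hat l u hu).of_le ENat.LEInfty.out
  choose! d' hd' using fun u hu => TestFunction.exists_weak_deriv (hc u hu)
  refine ⟨d', fun l => ?_, fun u hu => ⟨fun x => ?_, ?_⟩⟩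
  · have : ContDiffOn ℝ ∞ (fun u => fderiv ℝ (fun u => l (d u)) u e) U :=
      ((hd l).fderiv_of_isOpen hU (by simp)).clm_apply contDiffOn_const
    refine this.congr fun u hu => ?_
    have h1 := ((hat l u hu).differentiableAt (by simp)).hasFDerivAt.hasLineDerivAt e
    rw [← hd' u hu l]
    exact h1.deriv
  -- Evaluation at `x` is a continuous functional.
  · have h1 := ((hc u hu ((BoundedContinuousFunction.evalCLM ℝ x).comp
      (TestFunction.toBoundedContinuousFunctionCLM ℝ))).differentiableAt two_ne_zero).hasDerivAt
    rwa [hd' u hu] at h1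
  · have := tendsto_dTopology_slope (hc u hu) (hd' u hu)
    simp only [zero_smul, add_zero] at this
    exact this

theorem mainTheorem6 {n : ℕ} (Ω : Opens (EuclideanSpace ℝ (Fin n))) :
    -- for linear `l : 𝓓(Ω) → ℝ`: distribution ↔ continuous in the D-topology ↔ smooth
    (∀ l : 𝓓(Ω, ℝ) →ₗ[ℝ] ℝ, List.TFAE [
      Continuous l,
      Continuous[Diffeology.dTopology, inferInstance] l,
      Diffeology.DSmooth l]) ∧
    -- difference quotients of a plot `d` converge in the D-topology to a plot `d'`,
    -- the partial derivative of `(u, x) ↦ d u x` in the direction `eᵢ`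
    (∀ (m : ℕ) (U : Set (EuclideanSpace ℝ (Fin m))), IsOpen U →
      ∀ d : EuclideanSpace ℝ (Fin m) → 𝓓(Ω, ℝ), IsCanonicalPlotOn U d →
      ∀ i : Fin m, ∃ d' : EuclideanSpace ℝ (Fin m) → 𝓓(Ω, ℝ), IsCanonicalPlotOn U d' ∧
        ∀ u ∈ U,
          (∀ x : EuclideanSpace ℝ (Fin n),
            HasDerivAt (fun h : ℝ => d (u + h • EuclideanSpace.single i 1) x) (d' u x) 0) ∧
          Filter.Tendsto
            (fun h : ℝ => h⁻¹ • (d (u + h • EuclideanSpace.single i 1) - d u))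
            (𝓝[≠] 0) (@nhds 𝓓(Ω, ℝ) Diffeology.dTopology (d' u))) := by
  refine ⟨fun l => ?_, fun m U hU d hd i => hd.exists_lineDeriv hU _⟩
  tfae_have 1 → 3 := fun hl k p hp => contDiffOn_univ.1 (hp ⟨l, hl⟩)
  tfae_have 3 → 2 := fun hl => hl.continuous
  tfae_have 2 → 1 := TestFunction.continuous_of_continuous_dTopology
  tfae_finish
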